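/- Let $E$ be a (real) Banach lattice, and write $E^+=\{x\in E: x\ge 0\}$. A sequence $(x_n)$ in $E$ is called uaw-null (unbounded absolutely weakly null) if for every $u\in E^+$ the sequence $(|x_n|\wedge u)$ converges to $0$ in the weak topology of $E$; it is called order bounded if it is contained in an order interval $[a,b]$ of $E$. A bounded linear operator $T:E\to X$ into a Banach space $X$ is called order weakly compact if $T([0,x])$ is a relatively weakly compact subset of $X$ for every $x\in E^+$. The Banach lattice $E$ is called order continuous if $\|x_\alpha\|\to 0$ for every decreasing net $(x_\alpha)$ in $E$ with infimum $0$. (I) For every Banach space $X$ and every bounded linear operator $T:E\to X$, the following statements are equivalent: (1) $T$ is order weakly compact; (2) for every order bounded uaw-null sequence $(x_n)\subset E^+$, $\lim_{n\to\infty}\|Tx_n\|=0$; (3) for every order bounded uaw-null sequence $(x_n)\subset E$, $\lim_{n\to\infty}\|Tx_n\|=0$. (II) The following statements are equivalent: (1) $E$ is order continuous; (2) for every order bounded uaw-null sequence $(x_n)\subset E^+$, $\lim_{n\to\infty}\|x_n\|=0$; (3) for every order bounded uaw-null sequence $(x_n)\subset E$, $\lim_{n\to\infty}\|x_n\|=0$.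 -/

import Mathlib

open Filter Topology

universe u v

namespace BanachLatticeUaw

section Lattice

variable {E : Type u} [NormedAddCommGroup E] [NormedSpace ℝ E] [Lattice E]

/-- Unbounded absolute weak convergence of `x` to `a` along the filter `l`: for every `w ≥ 0` in
`E`, `|x i - a| ∧ w` converges to `0` in the weak topology of `E`. -/
def UawTendsto {ι : Type*} (x : ι → E) (l : Filter ι) (a : E) : Prop :=
  ∀ w : E, 0 ≤ w → Tendsto (fun i => toWeakSpace ℝ E (|x i - a| ⊓ w)) l (𝓝 0)

/-- A sequence is uaw-null if it is uaw-convergent to `0`. -/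
def UawNull (x : ℕ → E) : Prop :=
  UawTendsto x atTop 0

/-- A sequence is order bounded if it is contained in some order interval `[a, b]`. -/
def OrderBoundedSeq (x : ℕ → E) : Prop :=
  ∃ a b : E, ∀ n, x n ∈ Set.Icc a b

variable (E) in
/-- The norm of `E` is order continuous: every decreasing net with infimum `0` is norm null.
(Nets indexed by the universe of `E` are enough: a decreasing net with infimum `0` can be replaced
by its range, which is a downward directed subset of `E`.) -/
def IsOrderContinuous : Prop :=
  ∀ (ι : Type u) [Preorder ι] [IsDirectedOrder ι] [Nonempty ι] (x : ι → E),
    Antitone x → IsGLB (Set.range x) 0 → Tendsto (fun i => ‖x i‖) atTop (𝓝 0)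

/-- A bounded linear operator `T : E → X` is order weakly compact if for every `a ≥ 0` the image
`T([0, a])` is relatively compact in the weak topology of `X`. -/
def IsOrderWeaklyCompact {X : Type v} [NormedAddCommGroup X] [NormedSpace ℝ X] (T : E →L[ℝ] X) :
    Prop :=
  ∀ a : E, 0 ≤ a → IsCompact (closure (toWeakSpace ℝ X '' (T '' Set.Icc 0 a)))

end Lattice

end BanachLatticeUaw

/-! All conditions are compared with one property, `MapsBoundedSeriesToNull`: `‖T (w n)‖ → 0` for
positive `w` with order bounded partial sums. Order weak compactness gives it by Orlicz–Pettis,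
since finite subsums stay in some `T [0, u]`. Condition (2) gives it because such `w` is uaw-null.

For the converses, let `ρ = opGauge T`, a monotone sublinear functional with `‖T x‖ ≤ 2 ρ |x|`. The
key is `exists_control`: on `[0, u]`, `ρ` is small wherever a suitable positive functional `φ` is
small. If `x` is order bounded and uaw-null then `φ |x n| → 0`, hence `‖T (x n)‖ → 0`. For weak
compactness, `[0, u]` behaves like an order interval of `L¹(φ)`: an almost uniformly convex function
brings convex hulls of initial segments and tails of any sequence close in `φ |·|`, so their images
are close in norm, which suffices by a James-type criterion.

For `T = id` the property amounts to order continuity: it makes decreasing positive nets Cauchy, and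
conversely order continuity applies to the differences between upper bounds and partial sums. -/

namespace BanachLatticeUaw

/-! ### Weak compactness criterion and Orlicz–Pettis -/

section WeakCompactness

variable {X : Type v} [NormedAddCommGroup X] [NormedSpace ℝ X]

/-- A functional on the dual at distance greater than `r` from the space is larger than `r` at a
norm one functional that annihilates a given finite set. -/
lemma exists_dual_vanishing_on_finset (L : StrongDual ℝ (StrongDual ℝ X)) {r : ℝ} (hr : 0 ≤ r)
    (hL : ∀ y : X, r < ‖L - NormedSpace.inclusionInDoubleDual ℝ X y‖) (s : Finset X) :
    ∃ f : StrongDual ℝ X, ‖f‖ ≤ 1 ∧ (∀ x ∈ s, f x = 0) ∧ r < L f := by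
  by_contra! hcon
  let J := NormedSpace.inclusionInDoubleDual ℝ X
  let Jl : X →ₗ[ℝ] (StrongDual ℝ X →ₗ[ℝ] ℝ) := ContinuousLinearMap.coeLM ℝ ∘ₗ J.toLinearMap
  let p : Submodule ℝ (StrongDual ℝ X) := ⨅ x : s, LinearMap.ker (Jl x)
  have hp : ∀ f ∈ p, ∀ x ∈ s, f x = 0 := fun f hf x hx => by
    have := (Submodule.mem_iInf _).1 hf ⟨x, hx⟩
    simpa [Jl, J] using this
  have hle : ∀ f ∈ p, L f ≤ r * ‖f‖ := by
    intro f hf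
    rcases eq_or_ne f 0 with rfl | h0
    · simp
    have hpos : 0 < ‖f‖ := norm_pos_iff.2 h0
    have h1 := hcon (‖f‖⁻¹ • f) (by rw [norm_smul, norm_inv, norm_norm, inv_mul_cancel₀ hpos.ne'])
      (fun x hx => by simp [hp f hf x hx])
    rw [map_smul, smul_eq_mul, inv_mul_le_iff₀ hpos] at h1
    linarith
  -- Extend `L` from the annihilator `p` of `s` with norm at most `r`. The difference `L - g` kills
  -- `p`, so it is a combination of evaluations at points of `s`, putting `L` within `r` of `X`.
  obtain ⟨g, hg, hgn⟩ := exists_extension_norm_eq p (L.comp p.subtypeL)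
  have hgr : ‖g‖ ≤ r := by
    rw [hgn]
    refine ContinuousLinearMap.opNorm_le_bound _ hr fun f => ?_
    have h1 := hle f f.2
    have h2 := hle (-f) (p.neg_mem f.2)
    rw [map_neg, norm_neg] at h2
    exact abs_le.2 ⟨by simpa using neg_le.1 h2, by simpa using h1⟩
  have hmem : ((L - g : StrongDual ℝ (StrongDual ℝ X)) : StrongDual ℝ X →ₗ[ℝ] ℝ) ∈
      Submodule.span ℝ (Set.range fun x : s => Jl x) := by
    refine mem_span_of_iInf_ker_le_ker fun f hf => ?_
    have := hg ⟨f, hf⟩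
    simp at this
    simp [this]
  have hspan : Submodule.span ℝ (Set.range fun x : s => Jl x) ≤ LinearMap.range Jl :=
    Submodule.span_le.2 (by rintro _ ⟨x, rfl⟩; exact ⟨x, rfl⟩)
  obtain ⟨y, hy⟩ := hspan hmem
  have hy' : L - J y = g := by
    have : J y = L - g := by
      ext f
      exact LinearMap.congr_fun hy f
    rw [this]; abel
  exact absurd (hL y) (by rw [hy']; exact not_lt.2 hgr)

/-- A bounded set in a Banach space is relatively weakly compact if in every sequence in it the
convex hulls of initial segments come arbitrarily close to the convex hulls of the tails. -/
theorem isCompact_closure_toWeakSpace_of_convexHull_close [CompleteSpace X] (K : Set X)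
    (hb : Bornology.IsBounded K)
    (h : ∀ x : ℕ → X, (∀ n, x n ∈ K) → ∀ ε : ℝ, 0 < ε → ∃ n, ∃ a ∈ convexHull ℝ (x '' Set.Iio n),
      ∃ b ∈ convexHull ℝ (x '' Set.Ici n), ‖a - b‖ < ε) :
    IsCompact (closure (toWeakSpace ℝ X '' K)) := by
  refine NormedSpace.isCompact_closure_of_isBounded ℝ X _ ?_ ?_
  · rwa [Set.preimage_image_eq _ (toWeakSpace ℝ X).injective]
  intro Λ hΛ
  by_contra hr
  let L : StrongDual ℝ (StrongDual ℝ X) := WeakDual.toStrongDual Λ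
  have hclosed : IsClosed (Set.range (NormedSpace.inclusionInDoubleDual ℝ X)) :=
    (NormedSpace.inclusionInDoubleDualLi (𝕜 := ℝ) (E := X)).isometry.isUniformInducing.isComplete_range.isClosed
  have hLS : L ∉ Set.range (NormedSpace.inclusionInDoubleDual ℝ X) := by
    rintro ⟨y, hy⟩
    exact hr ⟨toWeakSpace ℝ X y, hy⟩
  have hd := (hclosed.notMem_iff_infDist_pos (Set.range_nonempty _)).1 hLS
  set d := Metric.infDist L (Set.range (NormedSpace.inclusionInDoubleDual ℝ X)) with hd_def
  have hL : ∀ y : X, d / 2 < ‖L - NormedSpace.inclusionInDoubleDual ℝ X y‖ := fun y => by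
    have := Metric.infDist_le_dist_of_mem (x := L) (Set.mem_range_self
      (f := NormedSpace.inclusionInDoubleDual ℝ X) y)
    have := this.trans_eq (dist_eq_norm L (NormedSpace.inclusionInDoubleDual ℝ X y))
    linarith
  have happrox : ∀ s : Finset (StrongDual ℝ X), (∀ f ∈ s, d / 2 < L f) →
      ∃ x ∈ K, ∀ f ∈ s, d / 2 < f x := by
    intro s hs
    have hopen : IsOpen (⋂ f ∈ s, {M : WeakDual ℝ (StrongDual ℝ X) | d / 2 < M f}) :=
      isOpen_biInter_finset fun f _ => isOpen_lt continuous_const (WeakDual.eval_continuous f)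
    obtain ⟨_, hM, _, ⟨x, hx, rfl⟩, rfl⟩ := mem_closure_iff.1 hΛ _ hopen
      (Set.mem_iInter₂.2 hs)
    exact ⟨x, hx, fun f hf => Set.mem_iInter₂.1 hM f hf⟩
  classical
  -- A triangular system: the `n`-th functional vanishes at earlier points and exceeds `d / 2` at
  -- the `n`-th and later ones, so it separates the two hulls by `d / 2`.
  obtain ⟨q, hq, hqr⟩ := exists_seq_of_forall_finset_exists
    (fun q : X × StrongDual ℝ X => q.1 ∈ K ∧ ‖q.2‖ ≤ 1 ∧ d / 2 < L q.2 ∧ d / 2 < q.2 q.1)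
    (fun q q' => q'.2 q.1 = 0 ∧ d / 2 < q.2 q'.1) (by
      intro s hs
      obtain ⟨f, hf1, hf0, hfL⟩ := exists_dual_vanishing_on_finset L (by positivity) hL
        (s.image Prod.fst)
      obtain ⟨x, hx, hxf⟩ := happrox (insert f (s.image Prod.snd)) (by
        intro g hg
        rcases Finset.mem_insert.1 hg with rfl | hg
        · exact hfL
        · obtain ⟨q, hq, rfl⟩ := Finset.mem_image.1 hg
          exact (hs q hq).2.2.1)
      refine ⟨(x, f), ⟨hx, hf1, hfL, hxf f (Finset.mem_insert_self _ _)⟩, fun q hq => ⟨?_, ?_⟩⟩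
      · exact hf0 _ (Finset.mem_image_of_mem _ hq)
      · exact hxf _ (Finset.mem_insert_of_mem (Finset.mem_image_of_mem _ hq)))
  obtain ⟨n, a, ha, b, hb, hab⟩ := h (fun n => (q n).1) (fun n => (hq n).1) (d / 2) (by positivity)
  have ha0 : (q n).2 a = 0 := by
    have hsub : convexHull ℝ ((fun n => (q n).1) '' Set.Iio n) ⊆ {x | (q n).2 x = 0} :=
      convexHull_min (by rintro _ ⟨m, hm, rfl⟩; exact (hqr m n hm).1)
        (convex_hyperplane (q n).2.toLinearMap.isLinear 0)
    exact hsub ha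
  have hb0 : d / 2 < (q n).2 b := by
    have hsub : convexHull ℝ ((fun n => (q n).1) '' Set.Ici n) ⊆ {x | d / 2 < (q n).2 x} := by
      refine convexHull_min ?_ (convex_halfSpace_gt (q n).2.toLinearMap.isLinear _)
      rintro _ ⟨m, hm, rfl⟩
      rcases eq_or_lt_of_le (Set.mem_Ici.1 hm) with rfl | hm
      · exact (hq _).2.2.2
      · exact (hqr n m hm).2
    exact hsub hb
  have h2 : |(q n).2 (a - b)| ≤ ‖a - b‖ := by
    have := (q n).2.le_of_opNorm_le (hq n).2.1 (a - b)
    simpa using this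
  rw [map_sub, ha0, zero_sub, abs_neg] at h2
  linarith [le_abs_self ((q n).2 b)]

/-- If all finite sums of a real sequence are bounded, then the sequence is absolutely summable. -/
lemma summable_abs_of_abs_finset_sum_le {a : ℕ → ℝ} {M : ℝ}
    (h : ∀ s : Finset ℕ, |∑ n ∈ s, a n| ≤ M) : Summable fun n => |a n| := by
  refine summable_of_sum_le (c := 2 * M) (fun n => abs_nonneg _) fun s => ?_
  rw [← Finset.sum_filter_add_sum_filter_not s (fun n => 0 ≤ a n)]
  have h1 : ∑ n ∈ s with 0 ≤ a n, |a n| ≤ M := by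
    rw [Finset.sum_congr rfl fun n hn => abs_of_nonneg (Finset.mem_filter.1 hn).2]
    exact (le_abs_self _).trans (h _)
  have h2 : ∑ n ∈ s with ¬ 0 ≤ a n, |a n| ≤ M := by
    rw [Finset.sum_congr rfl fun n hn => abs_of_neg (not_le.1 (Finset.mem_filter.1 hn).2),
      Finset.sum_neg_distrib]
    exact (neg_le_abs _).trans (h _)
  linarith

/-- A form of the Orlicz–Pettis theorem: the terms of a series whose finite subsums lie in a
relatively weakly compact set are norm null. -/
theorem tendsto_norm_zero_of_finset_sum_mem (K : Set X)
    (hK : IsCompact (closure (toWeakSpace ℝ X '' K))) (w : ℕ → X)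
    (hw : ∀ s : Finset ℕ, ∑ n ∈ s, w n ∈ K) : Tendsto (fun n => ‖w n‖) atTop (𝓝 0) := by
  have hcont : ∀ φ : StrongDual ℝ X, Continuous fun x : WeakSpace ℝ X =>
      φ ((toWeakSpace ℝ X).symm x) := fun φ => WeakBilin.eval_continuous _ φ
  have hsum : ∀ φ : StrongDual ℝ X, Summable fun n => |φ (w n)| := by
    intro φ
    obtain ⟨M, hM⟩ := (hK.image (hcont φ)).isBounded.exists_norm_le
    refine summable_abs_of_abs_finset_sum_le (M := M) fun s => ?_
    rw [← map_sum]
    exact hM _ ⟨_, subset_closure ⟨_, hw s, rfl⟩, rfl⟩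
  have hsumA : ∀ (φ : StrongDual ℝ X) (A : ℕ → Bool),
      Summable fun n => if A n then φ (w n) else 0 := fun φ A => by
    refine Summable.of_norm_bounded (hsum φ) fun n => ?_
    split_ifs <;> simp
  -- Every subseries has a weak sum: an ultrafilter limit of its partial sums, identified by testing
  -- against functionals.
  have hex : ∀ A : ℕ → Bool, ∃ x : X, ∀ φ : StrongDual ℝ X,
      φ x = ∑' n, if A n then φ (w n) else 0 := by
    intro A
    let P : ℕ → X := fun N => ∑ n ∈ (Finset.range N).filter (fun n => A n), w n
    obtain ⟨x, -, hx⟩ := isCompact_iff_ultrafilter_le_nhds.1 hK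
      ((hyperfilter ℕ).map fun N => toWeakSpace ℝ X (P N)) (by
        rw [Ultrafilter.coe_map]
        refine tendsto_principal.2 ?_
        exact Eventually.of_forall fun N => subset_closure ⟨P N, hw _, rfl⟩)
    refine ⟨(toWeakSpace ℝ X).symm x, fun φ => ?_⟩
    have h1 : Tendsto (fun N => φ (P N)) (hyperfilter ℕ) (𝓝 (φ ((toWeakSpace ℝ X).symm x))) :=
      ((hcont φ).tendsto x).comp (f := fun N => toWeakSpace ℝ X (P N)) hx
    have h2 : Tendsto (fun N => φ (P N)) (hyperfilter ℕ)
        (𝓝 (∑' n, if A n then φ (w n) else 0)) := by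
      refine ((hsumA φ A).hasSum.tendsto_sum_nat.mono_left Nat.hyperfilter_le_atTop).congr
        fun N => ?_
      rw [map_sum, Finset.sum_filter]
    exact tendsto_nhds_unique h1 h2
  choose f hf using hex
  have hfcont : ∀ φ : StrongDual ℝ X, Continuous fun A => φ (f A) := by
    intro φ
    simp_rw [hf]
    refine continuous_tsum (fun n => ?_) (hsum φ) fun n A => ?_
    · exact (continuous_of_discreteTopology (f := fun b : Bool => if b then φ (w n) else 0)).comp
        (continuous_apply n)
    · split_ifs <;> simp
  have hclosed : ∀ (c : X) (r : ℝ), IsClosed {A | ‖f A - c‖ ≤ r} := by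
    intro c r
    have : {A | ‖f A - c‖ ≤ r} =
        ⋂ φ : {φ : StrongDual ℝ X // ‖φ‖ ≤ 1}, {A | φ.1 (f A) - φ.1 c ≤ r} := by
      ext A
      simp only [Set.mem_ofPred_eq, Set.mem_iInter]
      constructor
      · intro h φ
        rw [← map_sub]
        have := φ.1.le_of_opNorm_le φ.2 (f A - c)
        rw [one_mul] at this
        exact (le_abs_self _).trans (this.trans h)
      · intro h
        obtain ⟨φ, hφ, hφ'⟩ := exists_dual_vector'' ℝ (f A - c)
        have := h ⟨φ, hφ⟩
        rw [← map_sub, hφ'] at this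
        simpa using this
    rw [this]
    exact isClosed_iInter fun φ => isClosed_le ((hfcont φ.1).sub continuous_const) continuous_const
  let W : Submodule ℝ X := (Submodule.span ℝ (Set.range w)).topologicalClosure
  have hfW : ∀ A, f A ∈ W := by
    intro A
    by_contra hA
    obtain ⟨φ, c, hφ, hc⟩ := geometric_hahn_banach_closed_point W.convex
      (Submodule.isClosed_topologicalClosure _) hA
    have h0 : ∀ n, φ (w n) = 0 := by
      intro n
      by_contra hn
      have hwn : w n ∈ W := Submodule.le_topologicalClosure _ (Submodule.subset_span ⟨n, rfl⟩)
      have := hφ ((c / φ (w n)) • w n) (W.smul_mem _ hwn)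
      rw [map_smul, smul_eq_mul, div_mul_cancel₀ _ hn] at this
      exact lt_irrefl _ this
    have h1 := hφ 0 W.zero_mem
    rw [hf] at hc
    simp [h0] at hc h1
    linarith
  obtain ⟨c, hcc, hc⟩ : TopologicalSpace.IsSeparable (W : Set X) :=
    ((Set.countable_range w).isSeparable.span (R := ℝ)).closure
  refine tendsto_order.2 ⟨fun b hb => Eventually.of_forall fun n => hb.trans_le (norm_nonneg _),
    fun ε hε => ?_⟩
  have := hcc.to_subtype
  -- Baire on the Cantor space: `f` is within `ε / 3` of one point on an open set. Flipping a late
  -- coordinate of `A` stays in that set and changes `f A` by `± w n`.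
  obtain ⟨c₀, A, hA⟩ := nonempty_interior_of_iUnion_of_closed
    (f := fun c₀ : c => {A | ‖f A - c₀‖ ≤ ε / 3}) (fun c₀ => hclosed _ _) (by
      refine Set.eq_univ_of_forall fun A => Set.mem_iUnion.2 ?_
      obtain ⟨y, hy, hyd⟩ := Metric.mem_closure_iff.1 (hc (hfW A)) (ε / 3) (by positivity)
      exact ⟨⟨y, hy⟩, by rw [dist_eq_norm] at hyd; exact hyd.le⟩)
  have hlim : Tendsto (fun n => Function.update A n (!A n)) atTop (𝓝 A) := by
    refine tendsto_pi_nhds.2 fun i => tendsto_const_nhds.congr' ?_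
    filter_upwards [eventually_gt_atTop i] with n hn
    rw [Function.update_of_ne hn.ne]
  filter_upwards [hlim.eventually (mem_interior_iff_mem_nhds.1 hA)] with n hn
  have hA' := interior_subset hA
  have hdiff : ∀ φ : StrongDual ℝ X, φ (f (Function.update A n (!A n)) - f A) =
      if A n then -φ (w n) else φ (w n) := by
    intro φ
    rw [map_sub, hf, hf, ← (hsumA φ _).tsum_sub (hsumA φ A), tsum_eq_single n]
    · cases A n <;> simp
    · intro m hm
      rw [Function.update_of_ne hm, sub_self]
  have hnorm : ‖f (Function.update A n (!A n)) - f A‖ = ‖w n‖ := by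
    cases hAn : A n
    · congr 1
      exact (SeparatingDual.eq_iff_forall_dual_eq (R := ℝ)).2 fun φ => by
        have := hdiff φ
        simpa [hAn] using this
    · rw [← norm_neg (w n)]
      congr 1
      exact (SeparatingDual.eq_iff_forall_dual_eq (R := ℝ)).2 fun φ => by
        have := hdiff φ
        simpa [hAn] using this
  rw [← hnorm]
  calc ‖f (Function.update A n (!A n)) - f A‖
      ≤ ‖f (Function.update A n (!A n)) - c₀‖ + ‖f A - c₀‖ := by
        have := norm_sub_le (f (Function.update A n (!A n)) - c₀) (f A - c₀)
        rwa [sub_sub_sub_cancel_right] at this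
    _ ≤ ε / 3 + ε / 3 := add_le_add hn hA'
    _ < ε := by linarith

end WeakCompactness

/-! ### The sublinear gauge of an operator -/

section Gauge

variable {E : Type u} [NormedAddCommGroup E] [NormedSpace ℝ E] [Lattice E]
  {X : Type v} [NormedAddCommGroup X] [NormedSpace ℝ X]

/-- The supremum of `‖T y‖` over `0 ≤ y ≤ x⁺`. -/
noncomputable def opGauge (T : E →L[ℝ] X) (x : E) : ℝ :=
  sSup ((fun y => ‖T y‖) '' Set.Icc 0 x⁺)

/-- `T` maps the terms of every positive series with order bounded partial sums to a norm null
sequence. -/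
def MapsBoundedSeriesToNull (T : E →L[ℝ] X) : Prop :=
  ∀ (a : E) (w : ℕ → E), (∀ n, 0 ≤ w n) → (∀ n, ∑ i ∈ Finset.range n, w i ≤ a) →
    Tendsto (fun n => ‖T (w n)‖) atTop (𝓝 0)

lemma nonempty_opGauge (T : E →L[ℝ] X) (x : E) :
    ((fun y => ‖T y‖) '' Set.Icc 0 x⁺).Nonempty :=
  ⟨_, 0, ⟨le_rfl, posPart_nonneg x⟩, rfl⟩

lemma opGauge_posPart (T : E →L[ℝ] X) (x : E) : opGauge T x⁺ = opGauge T x := by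
  rw [opGauge, opGauge, posPart_of_nonneg (posPart_nonneg x)]

lemma exists_lt_norm_apply_of_lt_opGauge (T : E →L[ℝ] X) {x : E} (hx : 0 ≤ x) {c : ℝ} (hc : c < opGauge T x) :
    ∃ y, 0 ≤ y ∧ y ≤ x ∧ c < ‖T y‖ := by
  obtain ⟨_, ⟨y, hy, rfl⟩, h⟩ := exists_lt_of_lt_csSup (nonempty_opGauge T x) hc
  exact ⟨y, hy.1, by rw [← posPart_of_nonneg hx]; exact hy.2, h⟩

variable [IsOrderedAddMonoid E] [HasSolidNorm E] (T : E →L[ℝ] X)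

lemma norm_le_norm_of_nonneg_of_le {E : Type*} [NormedAddCommGroup E] [Lattice E]
    [IsOrderedAddMonoid E] [HasSolidNorm E] {x y : E} (hx : 0 ≤ x) (hxy : x ≤ y) : ‖x‖ ≤ ‖y‖ :=
  norm_le_norm_of_abs_le_abs (by rwa [abs_of_nonneg hx, abs_of_nonneg (hx.trans hxy)])

lemma norm_apply_le_of_mem_Icc_posPart {x y : E} (hy : y ∈ Set.Icc 0 x⁺) :
    ‖T y‖ ≤ ‖T‖ * ‖x‖ := by
  refine (T.le_opNorm y).trans (mul_le_mul_of_nonneg_left ?_ (norm_nonneg _))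
  refine (norm_le_norm_of_nonneg_of_le hy.1 hy.2).trans (norm_le_norm_of_abs_le_abs ?_)
  rw [abs_of_nonneg (posPart_nonneg x)]
  exact sup_le (le_abs_self x) (abs_nonneg x)

lemma bddAbove_opGauge (x : E) : BddAbove ((fun y => ‖T y‖) '' Set.Icc 0 x⁺) :=
  ⟨‖T‖ * ‖x‖, by rintro _ ⟨y, hy, rfl⟩; exact norm_apply_le_of_mem_Icc_posPart T hy⟩

lemma norm_apply_le_opGauge_of_le_posPart {x y : E} (hy : 0 ≤ y) (hyx : y ≤ x⁺) :
    ‖T y‖ ≤ opGauge T x :=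
  le_csSup (bddAbove_opGauge T x) ⟨y, ⟨hy, hyx⟩, rfl⟩

lemma norm_apply_le_opGauge {x y : E} (hy : 0 ≤ y) (hyx : y ≤ x) : ‖T y‖ ≤ opGauge T x :=
  norm_apply_le_opGauge_of_le_posPart T hy (hyx.trans (le_posPart x))

lemma opGauge_le_iff {x : E} {c : ℝ} :
    opGauge T x ≤ c ↔ ∀ y, 0 ≤ y → y ≤ x⁺ → ‖T y‖ ≤ c := by
  rw [opGauge, csSup_le_iff (bddAbove_opGauge T x) (nonempty_opGauge T x),
    Set.forall_mem_image]
  exact ⟨fun h y h0 hy => h ⟨h0, hy⟩, fun h y hy => h y hy.1 hy.2⟩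

lemma opGauge_nonneg (x : E) : 0 ≤ opGauge T x :=
  (norm_nonneg _).trans (norm_apply_le_opGauge_of_le_posPart T le_rfl (posPart_nonneg x))

lemma opGauge_le_norm (x : E) : opGauge T x ≤ ‖T‖ * ‖x‖ :=
  (opGauge_le_iff T).2 fun _ h0 hy => norm_apply_le_of_mem_Icc_posPart T ⟨h0, hy⟩

lemma opGauge_mono {x y : E} (h : x ≤ y) : opGauge T x ≤ opGauge T y :=
  (opGauge_le_iff T).2 fun _ h0 hz =>
    norm_apply_le_opGauge_of_le_posPart T h0 (hz.trans (posPart_mono h))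

lemma opGauge_of_nonpos {x : E} (hx : x ≤ 0) : opGauge T x = 0 := by
  refine le_antisymm ((opGauge_le_iff T).2 fun y h0 hy => ?_) (opGauge_nonneg T x)
  rw [posPart_of_nonpos hx] at hy
  simp [le_antisymm hy h0]

/-- Riesz decomposition: split `z ≤ x⁺ + y⁺` as `z ⊓ x⁺` plus a remainder below `y⁺`. -/
lemma opGauge_add_le (x y : E) : opGauge T (x + y) ≤ opGauge T x + opGauge T y := by
  refine (opGauge_le_iff T).2 fun z h0 hz => ?_
  have hle : (x + y)⁺ ≤ x⁺ + y⁺ := sup_le (add_le_add (le_posPart x) (le_posPart y))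
    (add_nonneg (posPart_nonneg x) (posPart_nonneg y))
  have h1 : z - z ⊓ x⁺ ≤ y⁺ := by
    rw [sub_le_comm]
    refine le_inf (sub_le_self _ (posPart_nonneg y)) ?_
    rw [sub_le_iff_le_add]
    exact hz.trans hle
  calc ‖T z‖ = ‖T (z ⊓ x⁺) + T (z - z ⊓ x⁺)‖ := by rw [← map_add, add_sub_cancel]
    _ ≤ ‖T (z ⊓ x⁺)‖ + ‖T (z - z ⊓ x⁺)‖ := norm_add_le _ _
    _ ≤ _ := add_le_add
      (norm_apply_le_opGauge_of_le_posPart T (le_inf h0 (posPart_nonneg x)) inf_le_right)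
      (norm_apply_le_opGauge_of_le_posPart T (sub_nonneg.2 inf_le_left) h1)

lemma opGauge_sub_inf_le (x y z : E) :
    opGauge T (x - y ⊓ z) ≤ opGauge T (x - y) + opGauge T (x - z) := by
  rw [← opGauge_posPart T (x - y), ← opGauge_posPart T (x - z)]
  refine (opGauge_mono T ?_).trans (opGauge_add_le T _ _)
  rw [sub_le_comm]
  refine le_inf ?_ ?_ <;> rw [sub_le_comm]
  · exact (le_posPart _).trans (le_add_of_nonneg_right (posPart_nonneg _))
  · exact (le_posPart _).trans (le_add_of_nonneg_left (posPart_nonneg _))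

lemma norm_apply_le_two_mul_opGauge_abs (x : E) : ‖T x‖ ≤ 2 * opGauge T |x| := by
  calc ‖T x‖ = ‖T x⁺ - T x⁻‖ := by rw [← map_sub, posPart_sub_negPart]
    _ ≤ ‖T x⁺‖ + ‖T x⁻‖ := norm_sub_le _ _
    _ ≤ opGauge T |x| + opGauge T |x| := add_le_add
      (norm_apply_le_opGauge T (posPart_nonneg x) (sup_le (le_abs_self x) (abs_nonneg x)))
      (norm_apply_le_opGauge T (negPart_nonneg x) (sup_le (neg_le_abs x) (abs_nonneg x)))
    _ = _ := (two_mul _).symm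

section Ordered

variable [IsOrderedModule ℝ E]

lemma opGauge_smul_le {c : ℝ} (hc : 0 < c) (x : E) : opGauge T (c • x) ≤ c * opGauge T x := by
  refine (opGauge_le_iff T).2 fun y h0 hy => ?_
  have hle : (c • x)⁺ ≤ c • x⁺ := sup_le (smul_le_smul_of_nonneg_left (le_posPart x) hc.le)
    (smul_nonneg hc.le (posPart_nonneg x))
  have h1 : c⁻¹ • y ≤ x⁺ := by
    have := smul_le_smul_of_nonneg_left (hy.trans hle) (inv_nonneg.2 hc.le)
    rwa [smul_smul, inv_mul_cancel₀ hc.ne', one_smul] at this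
  have h2 := norm_apply_le_opGauge_of_le_posPart T (smul_nonneg (inv_nonneg.2 hc.le) h0) h1
  rwa [map_smul, norm_smul, norm_inv, Real.norm_of_nonneg hc.le, inv_mul_le_iff₀ hc] at h2

lemma opGauge_smul {c : ℝ} (hc : 0 < c) (x : E) : opGauge T (c • x) = c * opGauge T x := by
  refine le_antisymm (opGauge_smul_le T hc x) ?_
  have := opGauge_smul_le T (inv_pos.2 hc) (c • x)
  rwa [smul_smul, inv_mul_cancel₀ hc.ne', one_smul, ← div_eq_inv_mul, le_div_iff₀ hc,
    mul_comm] at this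

/-- The gauge is attained at a given point by a continuous functional which it dominates. -/
lemma exists_dual_le_opGauge (x : E) :
    ∃ φ : StrongDual ℝ E, (∀ y, φ y ≤ opGauge T y) ∧ φ x = opGauge T x := by
  rcases eq_or_ne x 0 with rfl | hx
  · exact ⟨0, fun y => opGauge_nonneg T y, by simp [opGauge_of_nonpos T le_rfl]⟩
  obtain ⟨g, hg, hgle⟩ := exists_extension_of_le_sublinear
    (LinearPMap.mkSpanSingleton x (opGauge T x) hx) (opGauge T)
    (fun c hc y => opGauge_smul T hc y) (opGauge_add_le T) (by
      rintro ⟨y, hy⟩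
      obtain ⟨c, rfl⟩ := Submodule.mem_span_singleton.1 hy
      refine (LinearPMap.mkSpanSingleton'_apply x (opGauge T x) _ c hy).trans_le ?_
      rcases lt_or_ge 0 c with hc | hc
      · simp [opGauge_smul T hc]
      · exact (mul_nonpos_of_nonpos_of_nonneg hc (opGauge_nonneg T x)).trans (opGauge_nonneg T _))
  refine ⟨g.mkContinuous ‖T‖ fun y => abs_le.2 ⟨?_, ?_⟩, hgle, ?_⟩
  · have := (hgle (-y)).trans (opGauge_le_norm T (-y))
    rw [map_neg, norm_neg] at this
    linarith
  · exact (hgle y).trans (opGauge_le_norm T y)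
  · exact (hg ⟨x, Submodule.mem_span_singleton_self x⟩).trans
      (LinearPMap.mkSpanSingleton'_apply_self _ _ _ _)

end Ordered

/-- The positive part in `opGauge` makes the gauge vanish on negative elements, which forces
dominated functionals to be positive. -/
lemma apply_nonneg_of_le_opGauge {T : E →L[ℝ] X} {φ : StrongDual ℝ E}
    (hφ : ∀ y, φ y ≤ opGauge T y) {y : E} (hy : 0 ≤ y) : 0 ≤ φ y := by
  have := hφ (-y)
  rw [opGauge_of_nonpos T (neg_nonpos.2 hy), map_neg] at this
  linarith

end Gauge

/-! ### Control of the gauge by a positive functional -/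

section Monotone

variable {E : Type u} [NormedAddCommGroup E] [NormedSpace ℝ E] [Lattice E]
  [IsOrderedAddMonoid E]
  {X : Type v} [NormedAddCommGroup X] [NormedSpace ℝ X] {T : E →L[ℝ] X}

/-- Otherwise there is a chain whose increments all have gauge at least `ε`. Their sums telescope,
so they are bounded by `b - a`, and elements below them violate the series property. -/
lemma MapsBoundedSeriesToNull.exists_opGauge_sub_lt_of_monotone (hT : MapsBoundedSeriesToNull T)
    {ι : Type*} [Preorder ι] [Nonempty ι] {z : ι → E} {a b : E} (hz : Monotone z)
    (hab : ∀ i, z i ∈ Set.Icc a b) {ε : ℝ} (hε : 0 < ε) :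
    ∃ i, ∀ j, i ≤ j → opGauge T (z j - z i) < ε := by
  by_contra! hcon
  choose G hG hGε using hcon
  let i₀ : ι := Classical.arbitrary ι
  let ψ : ℕ → ι := fun k => G^[k] i₀
  have hψ : ∀ k, ψ (k + 1) = G (ψ k) := fun k => Function.iterate_succ_apply' G k i₀
  have hd : ∀ k, 0 ≤ z (ψ (k + 1)) - z (ψ k) := fun k => by
    rw [hψ, sub_nonneg]; exact hz (hG _)
  have hdε : ∀ k, ε / 2 < opGauge T (z (ψ (k + 1)) - z (ψ k)) := fun k => by
    rw [hψ]; linarith [hGε (ψ k)]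
  choose y hy0 hyd hyε using fun k => exists_lt_norm_apply_of_lt_opGauge T (hd k) (hdε k)
  have hlim := hT (b - a) y hy0 fun n => by
    refine (Finset.sum_le_sum fun i _ => hyd i).trans ?_
    rw [Finset.sum_range_sub (fun k => z (ψ k))]
    exact sub_le_sub (hab _).2 (hab _).1
  obtain ⟨n, hn⟩ := (hlim.eventually (gt_mem_nhds (half_pos hε))).exists
  exact lt_asymm hn (hyε n)

lemma MapsBoundedSeriesToNull.exists_opGauge_sub_lt_of_antitone (hT : MapsBoundedSeriesToNull T)
    {ι : Type*} [Preorder ι] [Nonempty ι] {z : ι → E} {a b : E} (hz : Antitone z)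
    (hab : ∀ i, z i ∈ Set.Icc a b) {ε : ℝ} (hε : 0 < ε) :
    ∃ i, ∀ j, i ≤ j → opGauge T (z i - z j) < ε := by
  obtain ⟨i, hi⟩ := hT.exists_opGauge_sub_lt_of_monotone (z := fun i => -z i) (a := -b) (b := -a)
    (fun i j h => neg_le_neg (hz h)) (fun i => ⟨neg_le_neg (hab i).2, neg_le_neg (hab i).1⟩) hε
  exact ⟨i, fun j hj => by simpa [neg_add_eq_sub] using hi j hj⟩

/-- On an order interval, the gauge of `T` is absolutely continuous with respect to a positive
functional. -/
theorem MapsBoundedSeriesToNull.exists_control [HasSolidNorm E] [IsOrderedModule ℝ E]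
    (hT : MapsBoundedSeriesToNull T) (a : E) {ε : ℝ} (hε : 0 < ε) :
    ∃ φ : StrongDual ℝ E, (∀ y, 0 ≤ y → 0 ≤ φ y) ∧
      ∃ δ : ℝ, 0 < δ ∧ ∀ y ∈ Set.Icc 0 a, φ y < δ → opGauge T y < ε := by
  by_contra! hcon
  classical
  -- Choose `y n` almost null for the sum of all earlier functionals, and `φ n` attaining the gauge
  -- at `y n`. The third component is a counter that makes the smallness at least `(1 / 2) ^ n`.
  obtain ⟨q, hq, hqr⟩ := exists_seq_of_forall_finset_exists
    (fun q : E × StrongDual ℝ E × ℕ => q.1 ∈ Set.Icc 0 a ∧ (∀ y, q.2.1 y ≤ opGauge T y) ∧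
      ε ≤ q.2.1 q.1)
    (fun q q' => q.2.2 < q'.2.2 ∧ q.2.1 q'.1 < (1 / 2) ^ q'.2.2) (by
      intro s hs
      have hpos : ∀ q ∈ s, ∀ y, 0 ≤ y → 0 ≤ q.2.1 y := fun q hq y hy =>
        apply_nonneg_of_le_opGauge (hs q hq).2.1 hy
      obtain ⟨y, hy, hyδ, hyε⟩ := hcon (∑ q ∈ s, q.2.1) (fun y hy => by
        rw [_root_.sum_apply]
        exact Finset.sum_nonneg fun q hq => hpos q hq y hy)
        ((1 / 2) ^ (s.sup (fun q => q.2.2) + 1)) (by positivity)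
      obtain ⟨φ, hφ, hφy⟩ := exists_dual_le_opGauge T y
      refine ⟨(y, φ, s.sup (fun q => q.2.2) + 1), ⟨hy, hφ, by rw [hφy]; exact hyε⟩,
        fun q hq => ⟨Nat.lt_succ_of_le (Finset.le_sup (f := fun q => q.2.2) hq), ?_⟩⟩
      rw [_root_.sum_apply] at hyδ
      exact (Finset.single_le_sum (f := fun q => q.2.1 y) (fun q hq => hpos q hq y hy.1)
        hq).trans_lt hyδ)
  have hmono : StrictMono fun n => (q n).2.2 := fun m n h => (hqr m n h).1
  let y : ℕ → E := fun n => (q n).1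
  let φ : ℕ → StrongDual ℝ E := fun n => (q n).2.1
  have hy : ∀ n, y n ∈ Set.Icc 0 a := fun n => (hq n).1
  have hφ : ∀ n x, φ n x ≤ opGauge T x := fun n => (hq n).2.1
  have hφ0 : ∀ n x, 0 ≤ x → 0 ≤ φ n x := fun n x hx => apply_nonneg_of_le_opGauge (hφ n) hx
  have hφmono : ∀ n {x x'}, x ≤ x' → φ n x ≤ φ n x' := fun n x x' h => by
    have := hφ0 n _ (sub_nonneg.2 h)
    rw [map_sub] at this
    linarith
  have hφy : ∀ k n, k < n → φ k (y n) ≤ (1 / 2) ^ n := fun k n h =>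
    (hqr k n h).2.le.trans
      (pow_le_pow_of_le_one (by norm_num) (by norm_num) (hmono.le_apply (x := n)))
  obtain ⟨δ, hδ, hδε⟩ : ∃ δ : ℝ, 0 < δ ∧ 8 * δ = ε := ⟨ε / 8, by positivity, by ring⟩
  -- `w n` replaces the possibly missing supremum of the tail `y n, y (n + 1), …`, and `t` the
  -- decreasing meets that would tend to the limsup of `y`.
  let S : ℕ → ℕ → E := fun n => partialSups fun i => y (n + i)
  have hS : ∀ n m, S n m ∈ Set.Icc 0 a := fun n m =>
    ⟨(hy _).1.trans (le_partialSups_of_le (fun i => y (n + i)) (Nat.zero_le m)),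
      partialSups_le _ _ _ fun i _ => (hy _).2⟩
  choose N hN using fun n => hT.exists_opGauge_sub_lt_of_monotone (z := S n)
    (partialSups_monotone _) (hS n) (show (0 : ℝ) < δ * (1 / 2) ^ n by positivity)
  let w : ℕ → E := fun n => S n (N n)
  have hw : ∀ n m, n ≤ m → opGauge T (y m - w n) ≤ δ * (1 / 2) ^ n := by
    intro n m hnm
    refine (opGauge_mono T (sub_le_sub_right ?_ _)).trans
      (hN n (max (m - n) (N n)) (le_max_right _ _)).le
    have := le_partialSups_of_le (fun i => y (n + i)) (le_max_left (m - n) (N n))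
    rwa [Nat.add_sub_cancel' hnm] at this
  let t : ℕ → E := fun n => Nat.rec (w 0) (fun k r => r ⊓ w (k + 1)) n
  have ht : ∀ n, t (n + 1) = t n ⊓ w (n + 1) := fun n => rfl
  have htw : ∀ n, t n ≤ w n := fun n => by
    cases n with
    | zero => exact le_rfl
    | succ n => exact inf_le_right
  have htanti : Antitone t := antitone_nat_of_succ_le fun n => inf_le_left
  have htmem : ∀ n, t n ∈ Set.Icc 0 a := fun n => by
    refine ⟨?_, (htw n).trans (hS n _).2⟩
    induction n with
    | zero => exact (hS _ _).1
    | succ n ih => exact le_inf ih (hS _ _).1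
  have hyt : ∀ n m, n ≤ m → opGauge T (y m - t n) ≤ ∑ i ∈ Finset.range (n + 1),
      δ * (1 / 2) ^ i := by
    intro n m hnm
    induction n with
    | zero => simpa [t] using hw 0 m hnm
    | succ n ih =>
      rw [Finset.sum_range_succ, ht]
      exact (opGauge_sub_inf_le T _ _ _).trans
        (add_le_add (ih (Nat.le_of_succ_le hnm)) (hw _ _ hnm))
  -- Split `y n = (y n - t n) + (t n - t k) + t k`. Under `φ n` the pieces are at most `2δ`, `δ`,
  -- `2δ`, the last because `t k` lies below a sum of late `y`'s. The total `5δ` is below `8δ = ε`.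
  obtain ⟨n, hn⟩ := hT.exists_opGauge_sub_lt_of_antitone htanti htmem hδ
  obtain ⟨k, hkn, hk⟩ : ∃ k, n < k ∧ ((1 : ℝ) / 2) ^ k < δ :=
    ((eventually_gt_atTop n).and ((tendsto_pow_atTop_nhds_zero_of_lt_one (by norm_num)
      (by norm_num)).eventually (gt_mem_nhds hδ))).exists
  have h1 : φ n (y n - t n) ≤ 2 * δ := by
    refine (hφ n _).trans ((hyt n n le_rfl).trans ?_)
    rw [← Finset.mul_sum]
    nlinarith [sum_geometric_two_le (n + 1)]
  have h2 : φ n (t n - t k) ≤ δ := (hφ n _).trans (hn k hkn.le).le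
  have h3 : φ n (t k) ≤ 2 * δ := by
    have hle : w k ≤ ∑ i ∈ Finset.range (N k + 1), y (k + i) :=
      partialSups_le _ _ _ fun i hi => Finset.single_le_sum (f := fun i => y (k + i))
        (fun i _ => (hy _).1) (Finset.mem_range.2 (Nat.lt_succ_of_le hi))
    refine (hφmono n ((htw k).trans hle)).trans ?_
    rw [map_sum]
    refine (Finset.sum_le_sum fun i _ => hφy n (k + i) (by omega)).trans ?_
    simp_rw [pow_add]
    rw [← Finset.mul_sum]
    have := sum_geometric_two_le (N k + 1)
    have h0 : (0 : ℝ) < (1 / 2) ^ k := by positivity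
    nlinarith
  have h4 : ε ≤ φ n (y n) := (hq n).2.2
  rw [map_sub] at h1 h2
  linarith

end Monotone

/-! ### An approximately uniformly convex function -/

section UniformConvexity

/-- If `z` lies below the distances from `c` to all the multiples `i • v`, `i ≤ k`, then it lies
below `v` up to the part of `c` beyond `k • v`. -/
lemma le_add_posPart_of_forall_le_abs_sub_nsmul {E : Type*} [AddCommGroup E] [Lattice E]
    [IsOrderedAddMonoid E] {c v z : E} (hc : 0 ≤ c) (hv : 0 ≤ v) (k : ℕ)
    (hz : ∀ i ≤ k, z ≤ |c - i • v|) : z ≤ v + (c - k • v)⁺ := by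
  induction k with
  | zero =>
    have := hz 0 le_rfl
    rw [zero_smul, sub_zero, abs_of_nonneg hc] at this
    rw [zero_smul, sub_zero, posPart_of_nonneg hc]
    exact this.trans (le_add_of_nonneg_left hv)
  | succ k ih =>
    have h1 : z ≤ v + (c - k • v)⁺ := ih fun i hi => hz i (hi.trans k.le_succ)
    have h2 := hz (k + 1) le_rfl
    have hp : c - (k + 1) • v = c - k • v - v := by rw [succ_nsmul]; abel
    rw [hp] at h2 ⊢
    set p := c - k • v
    set q := (p - v)⁺
    have hneg : (p - v)⁻ ≤ v + p⁻ := by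
      refine sup_le ?_ (add_nonneg hv (negPart_nonneg p))
      rw [neg_sub, sub_eq_add_neg]
      exact add_le_add_right (neg_le_negPart p) v
    have h3 : z - v ≤ q + p⁻ := by
      rw [← posPart_add_negPart] at h2
      rw [sub_le_iff_le_add]
      refine h2.trans ((add_le_add_right hneg _).trans_eq ?_)
      abel
    have h4 : z - v ≤ q + p⁺ :=
      (sub_le_iff_le_add'.2 h1).trans (le_add_of_nonneg_left (posPart_nonneg _))
    have h5 := le_inf h4 h3
    rw [← add_inf, posPart_inf_negPart_eq_zero, add_zero] at h5
    exact sub_le_iff_le_add'.1 h5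

variable {E : Type u} [AddCommGroup E] [Lattice E]

/-- The sum of the distances from `x` to the multiples `i • v`, `i ≤ k`. -/
def gridDist (v : E) (k : ℕ) (x : E) : E := ∑ i ∈ Finset.range (k + 1), |x - i • v|

variable [IsOrderedAddMonoid E]

lemma gridDist_nonneg (v : E) (k : ℕ) (x : E) : 0 ≤ gridDist v k x :=
  Finset.sum_nonneg fun _ _ => abs_nonneg _

lemma gridDist_le {v x : E} {k : ℕ} (hv : 0 ≤ v) (hx : x ∈ Set.Icc 0 (k • v)) :
    gridDist v k x ≤ (k + 1) • (k • v) := by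
  refine (Finset.sum_le_card_nsmul _ _ (k • v) fun i hi => ?_).trans_eq (by rw [Finset.card_range])
  have hik : i • v ≤ k • v := nsmul_le_nsmul_left hv (Nat.lt_succ_iff.1 (Finset.mem_range.1 hi))
  refine abs_le'.2 ⟨?_, ?_⟩
  · exact (sub_le_self _ (nsmul_nonneg hv i)).trans hx.2
  · rw [neg_sub]
    exact (sub_le_self _ hx.1).trans hik

/-- The map `gridDist` is uniformly convex up to an error of the size of the mesh. -/
lemma abs_sub_add_two_nsmul_gridDist_le [Module ℝ E] [IsOrderedModule ℝ E] {v a b c : E} {k : ℕ} (hv : 0 ≤ v)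
    (hc : c ∈ Set.Icc 0 (k • v)) (habc : a + b = c + c) :
    |a - b| + 2 • gridDist v k c ≤ gridDist v k a + gridDist v k b + 2 • v := by
  have key : ∀ i : ℕ, 0 ≤ |a - i • v| + |b - i • v| - 2 • |c - i • v| := by
    intro i
    have h1 : (2 : ℝ) • (c - i • v) = (a - i • v) + (b - i • v) := by
      rw [two_smul]
      calc c - i • v + (c - i • v) = (c + c) - i • v - i • v := by abel
        _ = _ := by rw [← habc]; abel
    have h2 : |c - i • v| ≤ (1 / 2 : ℝ) • (|a - i • v| + |b - i • v|) := by
      have h3 : c - i • v = (1 / 2 : ℝ) • ((a - i • v) + (b - i • v)) := by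
        rw [← h1, smul_smul]; norm_num
      refine abs_le'.2 ⟨?_, ?_⟩
      · rw [h3]
        exact smul_le_smul_of_nonneg_left (add_le_add (le_abs_self _) (le_abs_self _))
          (by norm_num)
      · rw [h3, ← smul_neg, neg_add]
        exact smul_le_smul_of_nonneg_left (add_le_add (neg_le_abs _) (neg_le_abs _))
          (by norm_num)
    have h4 := smul_le_smul_of_nonneg_left h2 (show (0 : ℝ) ≤ 2 by norm_num)
    rw [smul_smul, show (2 : ℝ) * (1 / 2) = 1 by norm_num, one_smul, two_smul, ← two_nsmul] at h4
    exact sub_nonneg.2 h4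
  have key2 : ∀ i : ℕ, |a - b| ≤ |a - i • v| + |b - i • v| := fun i => by
    have := abs_add_le (a - i • v) (-(b - i • v))
    rwa [abs_neg, ← sub_eq_add_neg, sub_sub_sub_cancel_right] at this
  set D : E := gridDist v k a + gridDist v k b - 2 • gridDist v k c with hD
  have hDsum : D = ∑ i ∈ Finset.range (k + 1),
      (|a - i • v| + |b - i • v| - 2 • |c - i • v|) := by
    rw [hD, Finset.sum_sub_distrib, Finset.sum_add_distrib, Finset.sum_nsmul]
    rfl
  -- `D` sums the nonnegative midpoint convexity defects, so it dominates each one. As the grid has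
  -- mesh `v`, a lower bound for every `|c - i • v|` is at most `v`.
  have hz : ∀ i ≤ k, (1 / 2 : ℝ) • (|a - b| - D) ≤ |c - i • v| := by
    intro i hi
    have h1 : |a - i • v| + |b - i • v| - 2 • |c - i • v| ≤ D := by
      rw [hDsum]
      exact Finset.single_le_sum (f := fun i : ℕ => |a - i • v| + |b - i • v| - 2 • |c - i • v|)
        (fun i _ => key i) (Finset.mem_range.2 (Nat.lt_succ_of_le hi))
    have h2 : |a - b| - D ≤ (2 : ℝ) • |c - i • v| := by
      rw [two_smul, ← two_nsmul, sub_le_iff_le_add]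
      refine (key2 i).trans ?_
      rwa [sub_le_iff_le_add'] at h1
    have := smul_le_smul_of_nonneg_left h2 (show (0 : ℝ) ≤ 1 / 2 by norm_num)
    rwa [smul_smul, show (1 / 2 : ℝ) * 2 = 1 by norm_num, one_smul] at this
  have h3 := le_add_posPart_of_forall_le_abs_sub_nsmul hc.1 hv k hz
  rw [posPart_of_nonpos (sub_nonpos.2 hc.2), add_zero] at h3
  have h4 := smul_le_smul_of_nonneg_left h3 (show (0 : ℝ) ≤ 2 by norm_num)
  rw [smul_smul, show (2 : ℝ) * (1 / 2) = 1 by norm_num, one_smul, two_smul, ← two_nsmul] at h4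
  rw [hD, sub_le_iff_le_add] at h4
  calc |a - b| + 2 • gridDist v k c
      ≤ 2 • v + (gridDist v k a + gridDist v k b - 2 • gridDist v k c) + 2 • gridDist v k c :=
        add_le_add_left h4 _
    _ = _ := by abel

end UniformConvexity

/-! ### Close convex combinations in the seminorm of a positive functional -/

section Convex

/-- A point of the convex hull of a tail of a sequence lies in the convex hull of some initial
segment. -/
lemma exists_mem_convexHull_image_Iio {E : Type*} [AddCommGroup E] [Module ℝ E] (x : ℕ → E)
    {n : ℕ} {a : E} (ha : a ∈ convexHull ℝ (x '' Set.Ici n)) :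
    ∃ k, n ≤ k ∧ a ∈ convexHull ℝ (x '' Set.Iio k) := by
  have hmono : Monotone fun k : ℕ => convexHull ℝ (x '' Set.Iio k) := fun i j hij =>
    convexHull_mono (Set.image_mono (Set.Iio_subset_Iio hij))
  have hconv : Convex ℝ (⋃ k : ℕ, convexHull ℝ (x '' Set.Iio k)) :=
    hmono.directed_le.convex_iUnion fun {k} => convex_convexHull ℝ _
  have hsub : convexHull ℝ (x '' Set.Ici n) ⊆ ⋃ k : ℕ, convexHull ℝ (x '' Set.Iio k) := by
    refine convexHull_min ?_ hconv
    rintro _ ⟨m, -, rfl⟩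
    exact Set.mem_iUnion.2 ⟨m + 1, subset_convexHull ℝ _ ⟨m, Nat.lt_succ_self m, rfl⟩⟩
  obtain ⟨k, hk⟩ := Set.mem_iUnion.1 (hsub ha)
  exact ⟨max n k, le_max_left _ _, hmono (le_max_right _ _) hk⟩

/-- The infima of `φ ∘ gridDist` over convex hulls of tails increase to a finite limit.
Near-minimisers `a` and `b`, with `b` from a later tail, have a midpoint that cannot do much better,
so uniform convexity makes them close. -/
lemma exists_convexHull_close_of_positive_functional {E : Type*} [NormedAddCommGroup E]
    [NormedSpace ℝ E] [Lattice E] [IsOrderedAddMonoid E] [IsOrderedModule ℝ E] {u : E} (hu : 0 ≤ u) {φ : StrongDual ℝ E}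
    (hφ : ∀ y, 0 ≤ y → 0 ≤ φ y) {δ : ℝ} (hδ : 0 < δ) (x : ℕ → E) (hx : ∀ n, x n ∈ Set.Icc 0 u) :
    ∃ n, ∃ a ∈ convexHull ℝ (x '' Set.Iio n), ∃ b ∈ convexHull ℝ (x '' Set.Ici n),
      φ |a - b| < δ := by
  have hφmono : ∀ {y z : E}, y ≤ z → φ y ≤ φ z := fun {y z} h => by
    have := hφ _ (sub_nonneg.2 h)
    rw [map_sub] at this
    linarith
  -- The mesh `u / k` is chosen so that the error `2 φ v` is below `δ / 2`; the tolerances `δ / 8`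
  -- below account for the other half.
  obtain ⟨k, hk⟩ := exists_nat_gt (4 * φ u / δ)
  have hk0 : (0 : ℝ) < k := (div_nonneg (mul_nonneg (by norm_num) (hφ u hu)) hδ.le).trans_lt hk
  let v : E := (k : ℝ)⁻¹ • u
  have hv : 0 ≤ v := smul_nonneg (inv_nonneg.2 hk0.le) hu
  have hkv : k • v = u := by
    rw [← Nat.cast_smul_eq_nsmul ℝ, smul_smul, mul_inv_cancel₀ hk0.ne', one_smul]
  have hφv : 2 * φ v < δ / 2 := by
    rw [map_smul, smul_eq_mul]
    rw [div_lt_iff₀ hδ] at hk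
    rw [inv_mul_eq_div, ← mul_div_assoc, div_lt_iff₀ hk0]
    linarith
  let G : E → ℝ := fun y => φ (gridDist v k y)
  have hG0 : ∀ y, 0 ≤ G y := fun y => hφ _ (gridDist_nonneg v k y)
  let C : ℕ → Set E := fun n => convexHull ℝ (x '' Set.Ici n)
  have hCu : ∀ n, C n ⊆ Set.Icc 0 u := fun n =>
    convexHull_min (by rintro _ ⟨m, -, rfl⟩; exact hx m) (convex_Icc 0 u)
  have hCmono : ∀ {m n}, m ≤ n → C n ⊆ C m := fun {m n} h =>
    convexHull_mono (Set.image_mono (Set.Ici_subset_Ici.2 h))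
  have hxC : ∀ n, x n ∈ C n := fun n => subset_convexHull ℝ _ ⟨n, Set.self_mem_Ici, rfl⟩
  have hbdd : ∀ n, BddBelow (G '' C n) := fun n => ⟨0, by rintro _ ⟨y, -, rfl⟩; exact hG0 y⟩
  have hne : ∀ n, (G '' C n).Nonempty := fun n => ⟨_, x n, hxC n, rfl⟩
  let I : ℕ → ℝ := fun n => sInf (G '' C n)
  have hI : BddAbove (Set.range I) := by
    refine ⟨φ ((k + 1) • (k • v)), ?_⟩
    rintro _ ⟨n, rfl⟩
    refine (csInf_le (hbdd n) ⟨x n, hxC n, rfl⟩).trans (hφmono (gridDist_le hv ?_))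
    rw [hkv]
    exact hx n
  obtain ⟨n, hn⟩ := exists_lt_of_lt_ciSup (show iSup I - δ / 8 < iSup I by linarith)
  obtain ⟨_, ⟨a, ha, rfl⟩, haG⟩ := exists_lt_of_csInf_lt (hne n)
    (show sInf (G '' C n) < iSup I + δ / 8 by linarith [le_ciSup hI n])
  obtain ⟨m, hnm, ham⟩ := exists_mem_convexHull_image_Iio x ha
  obtain ⟨_, ⟨b, hb, rfl⟩, hbG⟩ := exists_lt_of_csInf_lt (hne m)
    (show sInf (G '' C m) < iSup I + δ / 8 by linarith [le_ciSup hI m])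
  refine ⟨m, a, ham, b, hb, ?_⟩
  let c : E := (1 / 2 : ℝ) • a + (1 / 2 : ℝ) • b
  have hc : c ∈ C n := convex_convexHull ℝ _ ha (hCmono hnm hb) (by norm_num) (by norm_num)
    (by norm_num)
  have hcG : iSup I - δ / 8 < G c := hn.trans_le (csInf_le (hbdd n) ⟨c, hc, rfl⟩)
  have habc : a + b = c + c := by
    simp only [c]
    module
  have h := hφmono (abs_sub_add_two_nsmul_gridDist_le hv (by rw [hkv]; exact hCu n hc) habc)
  simp only [map_add, map_nsmul, nsmul_eq_mul, Nat.cast_ofNat] at h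
  simp only [G] at haG hbG hcG
  linarith

end Convex

/-! ### From the series property to the operator conditions and back -/

section OperatorCriteria

variable {E : Type u} [NormedAddCommGroup E] [NormedSpace ℝ E] [Lattice E]
  [IsOrderedAddMonoid E]
  {X : Type v} [NormedAddCommGroup X] [NormedSpace ℝ X] {T : E →L[ℝ] X}

lemma IsOrderWeaklyCompact.mapsBoundedSeriesToNull (hT : IsOrderWeaklyCompact T) :
    MapsBoundedSeriesToNull T := by
  intro u w hw hwu
  have hu : 0 ≤ u := by simpa using hwu 0
  refine tendsto_norm_zero_of_finset_sum_mem (T '' Set.Icc 0 u) (hT u hu) _ fun s => ?_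
  refine ⟨∑ n ∈ s, w n, ⟨Finset.sum_nonneg fun n _ => hw n, ?_⟩, map_sum T w s⟩
  obtain ⟨n, hn⟩ := s.exists_nat_subset_range
  exact (Finset.sum_le_sum_of_subset_of_nonneg hn fun i _ _ => hw i).trans (hwu n)

variable [HasSolidNorm E]

/-- Finite sums of the truncations `w n ⊓ c` stay below `u`, so each functional is absolutely
summable along them. -/
lemma uawNull_of_sum_le {u : E} {w : ℕ → E} (hw : ∀ n, 0 ≤ w n)
    (hwu : ∀ n, ∑ i ∈ Finset.range n, w i ≤ u) : UawNull w := by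
  intro c hc
  refine (WeakBilin.tendsto_iff_forall_eval_tendsto _ (fun x y hxy =>
    (SeparatingDual.eq_iff_forall_dual_eq (R := ℝ)).2 fun φ => LinearMap.congr_fun hxy φ)).2
    fun φ => ?_
  change Tendsto (fun n => φ (|w n - 0| ⊓ c)) atTop (𝓝 (φ 0))
  rw [map_zero]
  have hnn : ∀ n, 0 ≤ |w n - 0| ⊓ c := fun n => le_inf (abs_nonneg _) hc
  refine (summable_abs_iff.1 (summable_abs_of_abs_finset_sum_le (M := ‖φ‖ * ‖u‖)
    fun s => ?_)).tendsto_atTop_zero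
  rw [← map_sum]
  refine (φ.le_opNorm _).trans (mul_le_mul_of_nonneg_left
    (norm_le_norm_of_nonneg_of_le (Finset.sum_nonneg fun n _ => hnn n) ?_) (norm_nonneg _))
  obtain ⟨n, hn⟩ := s.exists_nat_subset_range
  refine (Finset.sum_le_sum_of_subset_of_nonneg hn fun i _ _ => hnn i).trans
    ((Finset.sum_le_sum fun i _ => ?_).trans (hwu n))
  rw [sub_zero, abs_of_nonneg (hw i)]
  exact inf_le_left

lemma mapsBoundedSeriesToNull_of_forall_uawNull
    (h : ∀ x : ℕ → E, OrderBoundedSeq x → (∀ n, 0 ≤ x n) → UawNull x →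
      Tendsto (fun n => ‖T (x n)‖) atTop (𝓝 0)) : MapsBoundedSeriesToNull T := by
  intro u w hw hwu
  refine h w ⟨0, u, fun n => ⟨hw n, ?_⟩⟩ hw (uawNull_of_sum_le hw hwu)
  exact (Finset.single_le_sum (fun i _ => hw i) (Finset.self_mem_range_succ n)).trans (hwu (n + 1))

variable [IsOrderedModule ℝ E]

/-- An operator that maps order bounded positive series to null sequences is order weakly
compact. -/
theorem MapsBoundedSeriesToNull.isOrderWeaklyCompact [CompleteSpace X]
    (hT : MapsBoundedSeriesToNull T) : IsOrderWeaklyCompact T := by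
  intro u hu
  refine isCompact_closure_toWeakSpace_of_convexHull_close _ ?_ fun x hx ε hε => ?_
  · refine isBounded_iff_forall_norm_le.2 ⟨‖T‖ * ‖u‖, ?_⟩
    rintro _ ⟨y, hy, rfl⟩
    exact (T.le_opNorm y).trans
      (mul_le_mul_of_nonneg_left (norm_le_norm_of_nonneg_of_le hy.1 hy.2) (norm_nonneg _))
  choose y hy hyx using hx
  obtain ⟨φ, hφ, δ, hδ, hφδ⟩ := hT.exists_control u (half_pos hε)
  obtain ⟨n, a, ha, b, hb, hab⟩ :=
    exists_convexHull_close_of_positive_functional hu hφ hδ y hy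
  have himage : ∀ s : Set ℕ, ∀ z ∈ convexHull ℝ (y '' s), T z ∈ convexHull ℝ (x '' s) := by
    intro s z hz
    have h1 := T.toLinearMap.image_convexHull (y '' s)
    have h2 : T.toLinearMap '' (y '' s) = x '' s := by
      rw [Set.image_image]
      exact Set.image_congr fun i _ => hyx i
    rw [h2] at h1
    rw [← h1]
    exact ⟨z, hz, rfl⟩
  have hIcc : ∀ s : Set ℕ, convexHull ℝ (y '' s) ⊆ Set.Icc 0 u := fun s =>
    convexHull_min (by rintro _ ⟨m, -, rfl⟩; exact hy m) (convex_Icc 0 u)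
  refine ⟨n, T a, himage _ a ha, T b, himage _ b hb, ?_⟩
  have ha' := hIcc _ ha
  have hb' := hIcc _ hb
  have hmem : |a - b| ∈ Set.Icc 0 u := ⟨abs_nonneg _, abs_le'.2
    ⟨(sub_le_self _ hb'.1).trans ha'.2, by rw [neg_sub]; exact (sub_le_self _ ha'.1).trans hb'.2⟩⟩
  rw [← map_sub]
  linarith [norm_apply_le_two_mul_opGauge_abs T (a - b), hφδ _ hmem hab]

/-- Testing against the order bound `|a| ⊔ |b|` makes the truncation disappear, so the controlling
functional tends to zero along `|x n|`. -/
lemma MapsBoundedSeriesToNull.tendsto_norm_zero_of_uawNull (hT : MapsBoundedSeriesToNull T)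
    {x : ℕ → E} (hx : OrderBoundedSeq x) (hx0 : UawNull x) :
    Tendsto (fun n => ‖T (x n)‖) atTop (𝓝 0) := by
  obtain ⟨a, b, hab⟩ := hx
  have habs : ∀ n, |x n| ≤ |a| ⊔ |b| := fun n => abs_le'.2
    ⟨(hab n).2.trans ((le_abs_self b).trans le_sup_right),
      (neg_le_neg (hab n).1).trans ((neg_le_abs a).trans le_sup_left)⟩
  refine tendsto_order.2 ⟨fun c hc => Eventually.of_forall fun n => hc.trans_le (norm_nonneg _),
    fun ε hε => ?_⟩
  obtain ⟨φ, -, δ, hδ, hφδ⟩ := hT.exists_control (|a| ⊔ |b|) (half_pos hε)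
  have hlim : Tendsto (fun n => φ |x n|) atTop (𝓝 0) := by
    have h1 := (((WeakBilin.eval_continuous _ φ :
      Continuous fun y : WeakSpace ℝ E => φ ((toWeakSpace ℝ E).symm y))).tendsto 0).comp
      (hx0 (|a| ⊔ |b|) ((abs_nonneg a).trans le_sup_left))
    change Tendsto (fun n => φ (|x n - 0| ⊓ (|a| ⊔ |b|))) atTop (𝓝 (φ 0)) at h1
    rw [map_zero] at h1
    refine h1.congr fun n => ?_
    rw [sub_zero, inf_eq_left.2 (habs n)]
  filter_upwards [hlim.eventually (gt_mem_nhds hδ)] with n hn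
  linarith [norm_apply_le_two_mul_opGauge_abs T (x n), hφδ _ ⟨abs_nonneg _, habs n⟩ hn]

end OperatorCriteria

/-! ### Order continuity and the series property of the identity -/

section OrderContinuous

variable {E : Type u} [NormedAddCommGroup E] [NormedSpace ℝ E] [Lattice E]
  [IsOrderedAddMonoid E] [HasSolidNorm E]

lemma nonpos_of_forall_nsmul_le [IsOrderedModule ℝ E] {z u : E} (h : ∀ k : ℕ, k • z ≤ u) :
    z ≤ 0 := by
  have hlim : Tendsto (fun k : ℕ => ((k : ℝ) + 1)⁻¹ • u) atTop (𝓝 0) := by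
    have := (tendsto_one_div_add_atTop_nhds_zero_nat (𝕜 := ℝ)).smul_const u
    simpa using this
  refine ge_of_tendsto' hlim fun k => ?_
  have hk : (0 : ℝ) < (k : ℝ) + 1 := by positivity
  have := smul_le_smul_of_nonneg_left (h (k + 1)) (inv_nonneg.2 hk.le)
  rwa [← Nat.cast_smul_eq_nsmul ℝ, smul_smul, Nat.cast_succ, inv_mul_cancel₀ hk.ne', one_smul]
    at this

theorem IsOrderContinuous.mapsBoundedSeriesToNull [IsOrderedModule ℝ E]
    (hE : IsOrderContinuous E) : MapsBoundedSeriesToNull (ContinuousLinearMap.id ℝ E) := by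
  intro u w hw hwu
  let s : ℕ → E := fun n => ∑ i ∈ Finset.range n, w i
  have hs : Monotone s := monotone_nat_of_le_succ fun n => by
    simp only [s, Finset.sum_range_succ]
    exact le_add_of_nonneg_right (hw n)
  let U := {y : E // ∀ n, s n ≤ y}
  let ι : Type u := Uᵒᵈ × ℕ
  let z : ι → E := fun i => (OrderDual.ofDual i.1).1 - s i.2
  have : IsDirectedOrder ι := ⟨fun i j =>
    ⟨(OrderDual.toDual ⟨(OrderDual.ofDual i.1).1 ⊓ (OrderDual.ofDual j.1).1, fun n =>
      le_inf ((OrderDual.ofDual i.1).2 n) ((OrderDual.ofDual j.1).2 n)⟩, max i.2 j.2),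
      ⟨inf_le_left, le_max_left _ _⟩, ⟨inf_le_right, le_max_right _ _⟩⟩⟩
  have : Nonempty ι := ⟨(OrderDual.toDual ⟨u, hwu⟩, 0)⟩
  have hz : Antitone z := fun i j hij => sub_le_sub hij.1 (hs hij.2)
  have hglb : IsGLB (Set.range z) 0 := by
    refine ⟨?_, fun y hy => ?_⟩
    · rintro _ ⟨i, rfl⟩
      exact sub_nonneg.2 ((OrderDual.ofDual i.1).2 i.2)
    -- Subtracting the lower bound `y` from an upper bound of the partial sums leaves an upper
    -- bound. Iterating gives `k • y ≤ u` for all `k`, hence `y ≤ 0` by the Archimedean property.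
    have hstep : ∀ k : ℕ, ∀ n, s n ≤ u - k • y := by
      intro k
      induction k with
      | zero => simpa using hwu
      | succ k ih =>
        intro n
        have := hy ⟨(OrderDual.toDual (⟨u - k • y, ih⟩ : U), n), rfl⟩
        have h2 : y ≤ u - k • y - s n := this
        rw [succ_nsmul, ← sub_sub]
        exact le_sub_comm.1 h2
    refine nonpos_of_forall_nsmul_le (u := u) fun k => ?_
    have := hstep k 0
    simpa [s] using this
  have hlim := hE ι z hz hglb
  refine tendsto_order.2 ⟨fun c hc => Eventually.of_forall fun n => hc.trans_le (norm_nonneg _),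
    fun ε hε => ?_⟩
  obtain ⟨i, hi⟩ := (hlim.eventually (gt_mem_nhds hε)).exists
  filter_upwards [eventually_ge_atTop i.2] with n hn
  refine (norm_le_norm_of_nonneg_of_le (hw n) ?_).trans_lt hi
  have h1 : w n = s (n + 1) - s n := by simp [s, Finset.sum_range_succ]
  exact h1.trans_le (sub_le_sub ((OrderDual.ofDual i.1).2 _) (hs hn))

/-- The series property makes the net norm Cauchy. Closedness of the order makes its limit both
nonnegative and a lower bound, hence zero. -/
theorem MapsBoundedSeriesToNull.isOrderContinuous [CompleteSpace E]
    (hE : MapsBoundedSeriesToNull (ContinuousLinearMap.id ℝ E)) : IsOrderContinuous E := by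
  intro ι _ _ _ x hx hglb
  let i₀ : ι := Classical.arbitrary ι
  have hx0 : ∀ i, 0 ≤ x i := fun i => hglb.1 ⟨i, rfl⟩
  have hcauchy : ∀ ε : ℝ, 0 < ε → ∃ i, ∀ j, i ≤ j → ‖x i - x j‖ < ε := by
    intro ε hε
    -- Only beyond `i₀` is the net bounded above, by `x i₀`.
    have : Nonempty {i // i₀ ≤ i} := ⟨⟨i₀, le_rfl⟩⟩
    obtain ⟨i, hi⟩ := hE.exists_opGauge_sub_lt_of_antitone
      (z := fun i : {i // i₀ ≤ i} => x i) (a := 0) (b := x i₀) (fun i j hij => hx hij)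
      (fun i => ⟨hx0 i, hx i.2⟩) hε
    refine ⟨i, fun j hj => ?_⟩
    exact (norm_apply_le_opGauge (ContinuousLinearMap.id ℝ E) (sub_nonneg.2 (hx hj))
      le_rfl).trans_lt (hi ⟨j, i.2.trans hj⟩ hj)
  have hC : Cauchy (map x atTop) := by
    refine Metric.cauchy_iff.2 ⟨inferInstance, fun ε hε => ?_⟩
    obtain ⟨i, hi⟩ := hcauchy (ε / 2) (half_pos hε)
    refine ⟨x '' Set.Ici i, image_mem_map (mem_atTop i), ?_⟩
    rintro _ ⟨j, hj, rfl⟩ _ ⟨k, hk, rfl⟩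
    have h1 := hi j hj
    have h2 := hi k hk
    have h3 := dist_triangle_left (x j) (x k) (x i)
    rw [dist_eq_norm (x i) (x j), dist_eq_norm (x i) (x k)] at h3
    linarith
  obtain ⟨y, hy⟩ := CompleteSpace.complete hC
  have hy' : Tendsto x atTop (𝓝 y) := hy
  have hy0 : y = 0 := by
    refine le_antisymm (hglb.2 ?_) (ge_of_tendsto' hy' hx0)
    rintro _ ⟨i, rfl⟩
    exact le_of_tendsto hy' ((eventually_ge_atTop i).mono fun j hj => hx hj)
  simpa [hy0] using hy'.norm

end OrderContinuous

end BanachLatticeUaw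

/-! ### The two equivalences -/

theorem mainTheorem9 {E : Type u} [NormedAddCommGroup E] [NormedSpace ℝ E] [CompleteSpace E]
    [Lattice E] [IsOrderedAddMonoid E] [IsOrderedModule ℝ E] [HasSolidNorm E] :
    (∀ (X : Type v) [NormedAddCommGroup X] [NormedSpace ℝ X] [CompleteSpace X] (T : E →L[ℝ] X),
      List.TFAE
        [BanachLatticeUaw.IsOrderWeaklyCompact T,
         ∀ x : ℕ → E, BanachLatticeUaw.OrderBoundedSeq x → (∀ n, 0 ≤ x n) →
          BanachLatticeUaw.UawNull x → Tendsto (fun n => ‖T (x n)‖) atTop (𝓝 0),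
         ∀ x : ℕ → E, BanachLatticeUaw.OrderBoundedSeq x →
          BanachLatticeUaw.UawNull x → Tendsto (fun n => ‖T (x n)‖) atTop (𝓝 0)]) ∧
    List.TFAE
      [BanachLatticeUaw.IsOrderContinuous E,
       ∀ x : ℕ → E, BanachLatticeUaw.OrderBoundedSeq x → (∀ n, 0 ≤ x n) →
        BanachLatticeUaw.UawNull x → Tendsto (fun n => ‖x n‖) atTop (𝓝 0),
       ∀ x : ℕ → E, BanachLatticeUaw.OrderBoundedSeq x →
        BanachLatticeUaw.UawNull x → Tendsto (fun n => ‖x n‖) atTop (𝓝 0)] := by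
  refine ⟨fun X _ _ _ T => ?_, ?_⟩
  · tfae_have 1 → 3 := fun h _ hx hx0 =>
      h.mapsBoundedSeriesToNull.tendsto_norm_zero_of_uawNull hx hx0
    tfae_have 3 → 2 := fun h x hx _ hx0 => h x hx hx0
    tfae_have 2 → 1 := fun h =>
      (BanachLatticeUaw.mapsBoundedSeriesToNull_of_forall_uawNull h).isOrderWeaklyCompact
    tfae_finish
  · tfae_have 1 → 3 := fun h _ hx hx0 =>
      h.mapsBoundedSeriesToNull.tendsto_norm_zero_of_uawNull hx hx0
    tfae_have 3 → 2 := fun h x hx _ hx0 => h x hx hx0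
    tfae_have 2 → 1 := fun h => (BanachLatticeUaw.mapsBoundedSeriesToNull_of_forall_uawNull
      (T := ContinuousLinearMap.id ℝ E) h).isOrderContinuous
    tfae_finish
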